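/- Let \(d\in\mathbb N\), \(\delta>0\), and let \(f:\mathbb R^d\to\mathbb R\) be continuous, with at least one minimizer and \(\int_{\mathbb R^d} e^{-f(y)/\delta}\,dy<\infty\). For \(\lambda>0\) and \(x\in\mathbb R^d\) let \[ f^{\lambda,\delta}(x)=-\delta\log \mathbb E_{y\sim\mathcal N(x,\lambda\delta I)}\big[e^{-f(y)/\delta}\big],\qquad \operatorname{zprox}(x)=\frac{\mathbb E_{y\sim\mathcal N(x,\lambda\delta I)}\big[y\,e^{-f(y)/\delta}\big]}{\mathbb E_{y\sim\mathcal N(x,\lambda\delta I)}\big[e^{-f(y)/\delta}\big]}, \] let \(\mu_x\) be the probability measure on \(\mathbb R^d\) with Lebesgue density proportional to \(\exp\big(-\tfrac1\delta\big(f(y)+\tfrac{1}{2\lambda}\|x-y\|^2\big)\big)\), and let \(\Sigma(x)=\int_{\mathbb R^d}(y-\operatorname{zprox}(x))(y-\operatorname{zprox}(x))^\top\,d\mu_x(y)\). For every \(\lambda>0\) the function \(f^{\lambda,\delta}\) is twice differentiable on \(\mathbb R^d\), and for all \(x\in\mathbb R^d\) \[ \nabla^2 f^{\lambda,\delta}(x)=\frac1\lambda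 I-\frac{1}{\lambda^2\delta}\Sigma(x). \] Moreover: (i) If \(f\in C^1\) and there are \(m>0\), \(b\ge 0\) with \(\langle\nabla f(y),y\rangle\ge m\|y\|^2-b\) for all \(y\in\mathbb R^d\), then for every \(R>0\) the function \(f^{\lambda,\delta}\) is convex on the closed ball \(\{x:\|x\|\le R\}\) for every \(\lambda>0\) with \[ \lambda\ge\frac{\delta d+b+\sqrt{(\delta d+b)^2+2\delta mR^2}}{2\delta m}. \] (ii) If \(f(y)=\frac{\kappa}{2}\|y\|^2+V(y)\) for all \(y\in\mathbb R^d\), where \(\kappa>0\) and \(V:\mathbb R^d\to\mathbb R\) is bounded, with oscillation \(\operatorname{osc}(V)=\sup V-\inf V\), then \(f^{\lambda,\delta}\) is convex on \(\mathbb R^d\) for every \(\lambda>0\) with \[ \lambda\ge\frac{e^{\operatorname{osc}(V)/\delta}-1}{\kappa}. \] -/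

import Mathlib

open MeasureTheory ProbabilityTheory

noncomputable section

namespace SoftMoreau

/-- Standing assumptions on the objective `f` at temperature `δ`: `f` is continuous, has a
minimizer, and `exp (-f / δ)` is Lebesgue integrable. -/
structure StandingAssumption {d : ℕ} (δ : ℝ) (f : EuclideanSpace ℝ (Fin d) → ℝ) : Prop where
  continuous : Continuous f
  exists_minimizer : ∃ x, ∀ y, f x ≤ f y
  integrable_exp : Integrable (fun y => Real.exp (-f y / δ))

/-- The Gaussian distribution `N(x, v I)` on `ℝᵈ`. -/
def isoGaussian {d : ℕ} (x : EuclideanSpace ℝ (Fin d)) (v : ℝ) :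
    Measure (EuclideanSpace ℝ (Fin d)) :=
  multivariateGaussian x (v • (1 : Matrix (Fin d) (Fin d) ℝ))

/-- The soft Moreau envelope
`f^{lam, δ}(x) = -δ log E_{y ∼ N(x, lam δ I)} [exp (-f(y) / δ)]`. -/
def softMoreauEnvelope {d : ℕ} (f : EuclideanSpace ℝ (Fin d) → ℝ) (lam δ : ℝ)
    (x : EuclideanSpace ℝ (Fin d)) : ℝ :=
  -δ * Real.log (∫ y, Real.exp (-f y / δ) ∂(isoGaussian x (lam * δ)))

/-- The zeroth-order proximal operator: the quotient of `E[y exp (-f(y) / δ)]` by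
`E[exp (-f(y) / δ)]`, where `y ∼ N(x, lam δ I)`. -/
def zprox {d : ℕ} (f : EuclideanSpace ℝ (Fin d) → ℝ) (lam δ : ℝ)
    (x : EuclideanSpace ℝ (Fin d)) : EuclideanSpace ℝ (Fin d) :=
  (∫ y, Real.exp (-f y / δ) ∂(isoGaussian x (lam * δ)))⁻¹ •
    ∫ y, Real.exp (-f y / δ) • y ∂(isoGaussian x (lam * δ))

/-- The localized Gibbs measure: the probability measure with Lebesgue density proportional to
`exp (-(f(y) + ‖x - y‖² / (2 lam)) / δ)`. -/
def gibbs {d : ℕ} (f : EuclideanSpace ℝ (Fin d) → ℝ) (lam δ : ℝ)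
    (x : EuclideanSpace ℝ (Fin d)) : Measure (EuclideanSpace ℝ (Fin d)) :=
  (volume : Measure (EuclideanSpace ℝ (Fin d))).tilted
    (fun y => -(f y + ‖x - y‖ ^ 2 / (2 * lam)) / δ)

/-- The covariance operator `∫ (y - z) (y - z)ᵀ dμ_x(y)`, where `z` is the zeroth-order proximal
point at `x` and `μ_x` the localized Gibbs measure. Here `(innerSL ℝ w).smulRight w` is the
operator `w wᵀ : u ↦ ⟪w, u⟫ w`. -/
def gibbsCovariance {d : ℕ} (f : EuclideanSpace ℝ (Fin d) → ℝ) (lam δ : ℝ)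
    (x : EuclideanSpace ℝ (Fin d)) :
    EuclideanSpace ℝ (Fin d) →L[ℝ] EuclideanSpace ℝ (Fin d) :=
  ∫ y, (innerSL ℝ (y - zprox f lam δ x)).smulRight (y - zprox f lam δ x) ∂(gibbs f lam δ x)

/-- The global oscillation `sup V - inf V` (of a bounded function). -/
def osc {d : ℕ} (V : EuclideanSpace ℝ (Fin d) → ℝ) : ℝ := (⨆ y, V y) - ⨅ y, V y

end SoftMoreau

end

/-!
The envelope is a quadratic minus a log-Laplace transform. Expanding `‖x - y‖²`, the localized Gibbs
measures form the exponential family `gibbs f lam δ x = (gibbs f lam δ 0).tilted (⟪x, ·⟫ / (lam δ))`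
(`StandingAssumption.gibbs_eq_tilted`), whose base measure has all exponential moments. Once the
Gaussian is identified with its Lebesgue density (`isoGaussian_eq_tilted`, by comparing
characteristic functions), the envelope is `‖x‖² / (2 lam) - δ log M(x)` up to a constant, where `M`
is the Laplace transform of the base measure, and `zprox` is the mean of the family. Differentiating
under the integral sign twice, the gradient of `log M` is the mean and the derivative of the mean is
the covariance operator (`HasExpMoments.hasFDerivAt_mean_tilted`), which gives the Hessian.

Convexity on a convex set therefore amounts to the covariance bound `Σ(x) ≤ lam δ I` on that set
(`StandingAssumption.convexOn_softMoreauEnvelope`), and the covariance only grows when the mean is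
replaced by another centre.

* Under dissipativity the centre is `0`, and the second moment `A` of the Gibbs measure is bounded
  through the inequality that `∫ ⟪∇U, y⟫ = δ d` suggests, with `U(y) = f(y) + ‖x - y‖² / (2 lam)`.
  Integration by parts would need control on the growth of `∇f`. Instead the
  partition function is compared with its image under the dilations `y ↦ t y`, `t < 1`:
  dissipativity, integrated along rays, bounds `U(y) - U(t y)` from
  below, so only second moments have to be integrable, and `t → 1` gives the inequality
  (`StandingAssumption.moment_le_of_dissipative`). With `2 ⟪x, zprox(x)⟫ ≤ ‖x‖² + A`, the condition
  on `lam` yields `A ≤ lam δ`.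
* For a bounded perturbation `V` of `κ ‖y‖² / 2`, the Gibbs measure is the tilt by `-V / δ` of a
  Gaussian with covariance `lam δ / (κ lam + 1) I`. As in the Holley–Stroock perturbation lemma, the
  variances grow at most by the factor `exp (osc V / δ)` (`integral_tilted_le_exp_mul`).
-/

open MeasureTheory ProbabilityTheory

namespace SoftMoreau


/-! ### Exponential families and their log-Laplace transforms -/

section ExponentialFamily

lemma mul_inner_le_abs_mul_norm {E : Type*} [NormedAddCommGroup E] [InnerProductSpace ℝ E]
    (s : ℝ) (x y : E) : s * inner ℝ x y ≤ |s| * ‖x‖ * ‖y‖ := by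
  calc s * inner ℝ x y ≤ |s * inner ℝ x y| := le_abs_self _
    _ = |s| * |inner ℝ x y| := abs_mul _ _
    _ ≤ |s| * (‖x‖ * ‖y‖) := by gcongr; exact abs_real_inner_le_norm x y
    _ = _ := by ring

lemma integral_tilted_eq_inv_smul {α F : Type*} [MeasurableSpace α] [NormedAddCommGroup F]
    [NormedSpace ℝ F] (ν : Measure α) (f : α → ℝ) (g : α → F) :
    ∫ y, g y ∂(ν.tilted f) = (∫ y, Real.exp (f y) ∂ν)⁻¹ • ∫ y, Real.exp (f y) • g y ∂ν := by
  rw [integral_tilted, ← integral_smul]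
  simp only [div_eq_inv_mul, mul_smul]

variable {E F : Type*} [NormedAddCommGroup E] [MeasurableSpace E]
  [NormedAddCommGroup F] [NormedSpace ℝ F]

/-- The measure `ν` has exponential moments of every order. -/
def HasExpMoments (ν : Measure E) : Prop :=
  ∀ t : ℝ, Integrable (fun y => Real.exp (t * ‖y‖)) ν

variable [BorelSpace E] [SecondCountableTopology E] {ν : Measure E}

lemma HasExpMoments.integrable_pow_mul_exp (h : HasExpMoments ν) (k : ℕ) (t : ℝ) :
    Integrable (fun y => ‖y‖ ^ k * Real.exp (t * ‖y‖)) ν := by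
  refine Integrable.mono' ((h (t + 1)).const_mul (k.factorial : ℝ))
    (by fun_prop) (.of_forall fun y => ?_)
  have h1 := Real.pow_div_factorial_le_exp ‖y‖ (norm_nonneg y) k
  rw [div_le_iff₀ (by positivity)] at h1
  rw [Real.norm_of_nonneg (by positivity), add_mul, one_mul, Real.exp_add]
  calc _ ≤ (Real.exp ‖y‖ * k.factorial) * Real.exp (t * ‖y‖) := by gcongr
    _ = _ := by ring

variable [InnerProductSpace ℝ E]

lemma HasExpMoments.integrable_exp_inner_smul (h : HasExpMoments ν)
    {g : E → F} (hg : Continuous g) {k : ℕ} (hgk : ∀ y, ‖g y‖ ≤ ‖y‖ ^ k) (s : ℝ) (x : E) :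
    Integrable (fun y => Real.exp (s * inner ℝ x y) • g y) ν := by
  refine Integrable.mono' (h.integrable_pow_mul_exp k (|s| * ‖x‖))
    (Continuous.aestronglyMeasurable (by fun_prop)) (.of_forall fun y => ?_)
  rw [norm_smul, Real.norm_of_nonneg (by positivity), mul_comm]
  exact mul_le_mul (hgk y) (Real.exp_le_exp.2 (mul_inner_le_abs_mul_norm s x y))
    (by positivity) (by positivity)

lemma HasExpMoments.integrable_exp_inner (h : HasExpMoments ν) (s : ℝ) (x : E) :
    Integrable (fun y => Real.exp (s * inner ℝ x y)) ν := by
  simpa using h.integrable_exp_inner_smul (g := fun _ => (1 : ℝ)) (k := 0) continuous_const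
    (by simp) s x

lemma HasExpMoments.integrable_tilted (h : HasExpMoments ν)
    {g : E → F} (hg : Continuous g) {k : ℕ} (hgk : ∀ y, ‖g y‖ ≤ ‖y‖ ^ k) (s : ℝ) (x : E) :
    Integrable g (ν.tilted fun y => s * inner ℝ x y) := by
  rw [integrable_tilted_iff (h.integrable_exp_inner s x)]
  exact h.integrable_exp_inner_smul hg hgk s x

/-- Differentiation of a Laplace transform under the integral sign, for an integrand of at most
polynomial growth. -/
lemma HasExpMoments.hasFDerivAt_integral_exp_inner_smul (h : HasExpMoments ν)
    {g : E → F} (hg : Continuous g) {k : ℕ} (hgk : ∀ y, ‖g y‖ ≤ ‖y‖ ^ k) (s : ℝ) (x : E) :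
    HasFDerivAt (fun x => ∫ y, Real.exp (s * inner ℝ x y) • g y ∂ν)
      (∫ y, Real.exp (s * inner ℝ x y) • (s • (innerSL ℝ y).smulRight (g y)) ∂ν) x := by
  refine hasFDerivAt_integral_of_dominated_of_fderiv_le
    (F' := fun x y => Real.exp (s * inner ℝ x y) • (s • (innerSL ℝ y).smulRight (g y)))
    (bound := fun y => |s| * (‖y‖ ^ (k + 1) * Real.exp (|s| * (‖x‖ + 1) * ‖y‖)))
    (Metric.ball_mem_nhds x one_pos) (.of_forall fun z => ?_)
    (h.integrable_exp_inner_smul hg hgk s x)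
    (Continuous.aestronglyMeasurable (by fun_prop)) (.of_forall fun y z hz => ?_)
    ((h.integrable_pow_mul_exp _ _).const_mul _) (.of_forall fun y z hz => ?_)
  · exact (h.integrable_exp_inner_smul hg hgk s z).aestronglyMeasurable
  · rw [norm_smul, norm_smul, Real.norm_of_nonneg (by positivity),
      ContinuousLinearMap.norm_smulRight_apply, innerSL_apply_norm, Real.norm_eq_abs, pow_succ']
    have h1 : ‖z‖ ≤ ‖x‖ + 1 := by
      have := norm_le_norm_add_norm_sub' z x
      rw [Metric.mem_ball, dist_eq_norm] at hz
      linarith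
    have h2 : s * inner ℝ z y ≤ |s| * (‖x‖ + 1) * ‖y‖ :=
      (mul_inner_le_abs_mul_norm s z y).trans (by gcongr)
    calc _ ≤ Real.exp (|s| * (‖x‖ + 1) * ‖y‖) * (|s| * (‖y‖ * ‖y‖ ^ k)) := by
          refine mul_le_mul (Real.exp_le_exp.2 h2) ?_ (by positivity) (by positivity)
          gcongr
          exact hgk y
      _ = _ := by ring
  · have h1 : HasFDerivAt (fun z : E => s * inner ℝ z y) (s • innerSL ℝ y) z := by
      have := ((innerSL ℝ y).hasFDerivAt (x := z)).const_mul s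
      simpa [real_inner_comm] using this
    refine (h1.exp.smul_const (g y)).congr_fderiv ?_
    ext u
    simp [smul_smul, mul_assoc]

variable [CompleteSpace E] [NeZero ν]

lemma HasExpMoments.hasFDerivAt_integral_exp_inner (h : HasExpMoments ν) (s : ℝ) (x : E) :
    HasFDerivAt (fun x => ∫ y, Real.exp (s * inner ℝ x y) ∂ν)
      (((∫ y, Real.exp (s * inner ℝ x y) ∂ν) * s) •
        innerSL ℝ (∫ y, y ∂(ν.tilted fun y => s * inner ℝ x y))) x := by
  have h0 := h.hasFDerivAt_integral_exp_inner_smul (g := fun _ => (1 : ℝ)) (k := 0)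
    continuous_const (by simp) s x
  simp only [smul_eq_mul, mul_one] at h0
  refine h0.congr_fderiv ?_
  have hZ : (∫ y, Real.exp (s * inner ℝ x y) ∂ν) ≠ 0 :=
    (integral_exp_pos (h.integrable_exp_inner s x)).ne'
  have hi := h.integrable_exp_inner_smul (g := fun y : E => y) (k := 1) continuous_id (by simp) s x
  rw [integral_tilted_eq_inv_smul, map_smul, smul_smul, mul_right_comm,
    mul_inv_cancel₀ hZ, one_mul, ← ContinuousLinearMap.integral_comp_comm _ hi, ← integral_smul]
  congr with y u
  simp [innerSL_apply_apply ℝ]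
  ring

/-- The gradient of a log-Laplace transform is the mean of the tilted measure. -/
lemma HasExpMoments.hasGradientAt_log_integral_exp_inner (h : HasExpMoments ν) (s : ℝ) (x : E) :
    HasGradientAt (fun x => Real.log (∫ y, Real.exp (s * inner ℝ x y) ∂ν))
      (s • ∫ y, y ∂(ν.tilted fun y => s * inner ℝ x y)) x := by
  rw [hasGradientAt_iff_hasFDerivAt]
  have hZ : (∫ y, Real.exp (s * inner ℝ x y) ∂ν) ≠ 0 :=
    (integral_exp_pos (h.integrable_exp_inner s x)).ne'
  refine ((h.hasFDerivAt_integral_exp_inner s x).log hZ).congr_fderiv ?_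
  ext u
  simp [field]

/-- The covariance operator of a probability measure, `∫ (y - z) (y - z)ᵀ` with `z` the mean, is
`∫ y yᵀ - z zᵀ`. -/
lemma integral_smulRight_sub_mean {μ : Measure E} [IsProbabilityMeasure μ]
    (h1 : Integrable (fun y : E => y) μ)
    (h2 : Integrable (fun y : E => (innerSL ℝ y).smulRight y) μ) {z : E} (hz : ∫ y, y ∂μ = z) :
    ∫ y, (innerSL ℝ (y - z)).smulRight (y - z) ∂μ =
      ∫ y, (innerSL ℝ y).smulRight y ∂μ - (innerSL ℝ z).smulRight z := by
  have e : ∀ y : E, (innerSL ℝ (y - z)).smulRight (y - z) =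
      (innerSL ℝ y).smulRight y - (innerSL ℝ z).smulRight y - (innerSL ℝ y).smulRight z
        + (innerSL ℝ z).smulRight z := by
    intro y
    ext u
    simp [sub_smul, smul_sub]
    abel
  let A : E →L[ℝ] (E →L[ℝ] E) := ContinuousLinearMap.smulRightL ℝ E E (innerSL ℝ z)
  let B : (E →L[ℝ] ℝ) →L[ℝ] (E →L[ℝ] E) := (ContinuousLinearMap.smulRightL ℝ E E).flip z
  have hA : ∀ y, (innerSL ℝ z).smulRight y = A y := fun y => rfl
  have hB : ∀ y : E, (innerSL ℝ y).smulRight z = B (innerSL ℝ y) := fun y => rfl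
  have h1' : Integrable (fun y : E => innerSL ℝ y) μ :=
    h1.mono (Continuous.aestronglyMeasurable (by fun_prop)) (.of_forall fun y => by simp)
  have iA : Integrable (fun y => A y) μ := A.integrable_comp h1
  have iB : Integrable (fun y : E => B (innerSL ℝ y)) μ := B.integrable_comp h1'
  simp_rw [e, hA, hB]
  rw [integral_add, integral_sub, integral_sub, A.integral_comp_comm h1,
    B.integral_comp_comm h1', ContinuousLinearMap.integral_comp_comm _ h1, hz, integral_const,
    ← hB, ← hA]
  · simp
  exacts [h2, iA, h2.sub iA, iB, (h2.sub iA).sub iB, integrable_const _]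

/-- The derivative of the mean of the tilted measure is its covariance operator. -/
lemma HasExpMoments.hasFDerivAt_mean_tilted (h : HasExpMoments ν) (s : ℝ) (x : E) {z : E}
    (hz : ∫ y, y ∂(ν.tilted fun y => s * inner ℝ x y) = z) :
    HasFDerivAt (fun x => ∫ y, y ∂(ν.tilted fun y => s * inner ℝ x y))
      (s • ∫ y, (innerSL ℝ (y - z)).smulRight (y - z) ∂(ν.tilted fun y => s * inner ℝ x y)) x := by
  have hZi := h.integrable_exp_inner s x
  have hZ : (∫ y, Real.exp (s * inner ℝ x y) ∂ν) ≠ 0 := (integral_exp_pos hZi).ne'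
  have hG := h.hasFDerivAt_integral_exp_inner_smul (g := fun y : E => y) (k := 1) continuous_id
    (by simp) s x
  have hM := (hasDerivAt_inv hZ).comp_hasFDerivAt x (h.hasFDerivAt_integral_exp_inner s x)
  have := isProbabilityMeasure_tilted hZi
  have hi2 : Integrable (fun y : E => (innerSL ℝ y).smulRight y)
      (ν.tilted fun y => s * inner ℝ x y) :=
    h.integrable_tilted (k := 2) (by fun_prop)
      (fun y => by simp [ContinuousLinearMap.norm_smulRight_apply, sq]) s x
  have hi1 : Integrable (fun y : E => y) (ν.tilted fun y => s * inner ℝ x y) :=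
    h.integrable_tilted (k := 1) continuous_id (by simp) s x
  rw [integral_smulRight_sub_mean hi1 hi2 hz,
    integral_tilted_eq_inv_smul _ _ (fun y => (innerSL ℝ y).smulRight y)]
  simp_rw [integral_tilted_eq_inv_smul _ _ (fun y => y)]
  refine (hM.smul hG).congr_fderiv ?_
  simp_rw [smul_comm _ s]
  rw [integral_smul, hz]
  have hz' := hz
  rw [integral_tilted_eq_inv_smul, inv_smul_eq_iff₀ hZ] at hz'
  ext1 u
  simp [hz', smul_sub, smul_smul]
  match_scalars <;> field_simp

end ExponentialFamily


/-! ### Isotropic Gaussians as tilts of Lebesgue measure -/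

section Gaussian

lemma integrable_exp_neg_mul_sq_norm {V : Type*} [NormedAddCommGroup V] [InnerProductSpace ℝ V]
    [FiniteDimensional ℝ V] [MeasurableSpace V] [BorelSpace V] {b : ℝ} (hb : 0 < b) :
    Integrable (fun y : V => Real.exp (-b * ‖y‖ ^ 2)) := by
  have := (GaussianFourier.integrable_cexp_neg_mul_sq_norm_add (V := V) (b := (b : ℂ))
    (by simpa using hb) 0 0).norm
  simpa [Complex.norm_exp, ← Complex.ofReal_pow] using this

variable {d : ℕ}

lemma integrable_exp_neg_norm_sub_sq_div {v : ℝ} (hv : 0 < v) (x : EuclideanSpace ℝ (Fin d)) :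
    Integrable (fun y : EuclideanSpace ℝ (Fin d) => Real.exp (-‖x - y‖ ^ 2 / (2 * v))) := by
  have h := (integrable_exp_neg_mul_sq_norm (V := EuclideanSpace ℝ (Fin d))
    (b := (2 * v)⁻¹) (by positivity)).comp_sub_left x
  refine h.congr (.of_forall fun y => ?_)
  simp only
  congr 1
  ring

instance isProbabilityMeasure_isoGaussian (x : EuclideanSpace ℝ (Fin d)) (v : ℝ) :
    IsProbabilityMeasure (isoGaussian x v) := by
  unfold isoGaussian
  infer_instance

lemma posSemidef_smul_one {v : ℝ} (hv : 0 ≤ v) :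
    (v • (1 : Matrix (Fin d) (Fin d) ℝ)).PosSemidef :=
  Matrix.PosSemidef.one.smul hv

lemma dotProduct_smul_one_mulVec (v : ℝ) (t : EuclideanSpace ℝ (Fin d)) :
    t.ofLp ⬝ᵥ (v • (1 : Matrix (Fin d) (Fin d) ℝ)).mulVec t.ofLp = v * ‖t‖ ^ 2 := by
  rw [Matrix.smul_mulVec, Matrix.one_mulVec, dotProduct_smul, EuclideanSpace.real_norm_sq_eq]
  simp [dotProduct, sq]

/-- The Lebesgue density of `N(x, v I)` is proportional to `exp (-‖x - y‖² / (2 v))`. Both measures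
have the same characteristic function. -/
lemma isoGaussian_eq_tilted {v : ℝ} (hv : 0 < v) (x : EuclideanSpace ℝ (Fin d)) :
    isoGaussian x v = volume.tilted (fun y => -‖x - y‖ ^ 2 / (2 * v)) := by
  have hint := integrable_exp_neg_norm_sub_sq_div hv x
  have := isProbabilityMeasure_tilted hint
  apply Measure.ext_of_charFun
  ext t
  have hb : 0 < (((2 * v)⁻¹ : ℝ) : ℂ).re := by
    rw [Complex.ofReal_re]; positivity
  have h1 := GaussianFourier.integral_cexp_neg_mul_sq_norm_add (V := EuclideanSpace ℝ (Fin d)) hb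
    Complex.I t
  have h0 := GaussianFourier.integral_cexp_neg_mul_sq_norm (V := EuclideanSpace ℝ (Fin d)) hb
  set Z := ∫ y : EuclideanSpace ℝ (Fin d), Real.exp (-‖x - y‖ ^ 2 / (2 * v)) with hZ
  have hZ0 : (Z : ℂ) ≠ 0 := Complex.ofReal_ne_zero.2 (integral_exp_pos hint).ne'
  have hZC : (Z : ℂ) = ∫ y : EuclideanSpace ℝ (Fin d),
      Complex.exp (-(((2 * v)⁻¹ : ℝ) : ℂ) * ‖y‖ ^ 2) := by
    rw [hZ, ← integral_sub_left_eq_self _ volume x, ← integral_complex_ofReal]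
    refine integral_congr_ae (.of_forall fun y => ?_)
    simp only [sub_sub_cancel]
    push_cast
    congr 1
    ring
  have e : ∀ w : EuclideanSpace ℝ (Fin d),
      (Real.exp (-‖x - (x + w)‖ ^ 2 / (2 * v)) / Z) • Complex.exp (inner ℝ (x + w) t * Complex.I) =
      (Complex.exp (inner ℝ x t * Complex.I) / Z) *
        Complex.exp (-(((2 * v)⁻¹ : ℝ) : ℂ) * ‖w‖ ^ 2 + Complex.I * inner ℝ t w) := by
    intro w
    rw [Complex.real_smul, div_mul_eq_mul_div, ← Complex.exp_add, inner_add_left,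
      real_inner_comm w t, sub_add_cancel_left, norm_neg]
    push_cast
    rw [div_mul_eq_mul_div, ← Complex.exp_add]
    congr 2
    ring
  rw [isoGaussian, charFun_multivariateGaussian (posSemidef_smul_one hv.le), charFun_apply,
    integral_tilted, ← hZ,
    ← integral_add_left_eq_self _ x]
  simp_rw [e]
  rw [integral_const_mul, h1, ← h0, ← hZC, div_mul_eq_mul_div, mul_div_assoc,
    mul_div_cancel_left₀ _ hZ0, ← Complex.exp_add]
  congr 1
  rw [dotProduct_smul_one_mulVec, real_inner_comm, Complex.I_sq]
  push_cast
  have : (v : ℂ) ≠ 0 := Complex.ofReal_ne_zero.2 hv.ne'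
  field_simp
  ring

lemma memLp_id_isoGaussian (x : EuclideanSpace ℝ (Fin d)) (v : ℝ) :
    MemLp id 2 (isoGaussian x v) := by
  unfold isoGaussian
  exact IsGaussian.memLp_two_id

/-- The covariance of `N(x, v I)` is `v I`. -/
lemma integral_inner_sub_sq_isoGaussian {v : ℝ} (hv : 0 ≤ v) (x u : EuclideanSpace ℝ (Fin d)) :
    ∫ y, inner ℝ (y - x) u ^ 2 ∂(isoGaussian x v) = v * ‖u‖ ^ 2 := by
  have h := covarianceBilin_multivariateGaussian (μ := x) (posSemidef_smul_one hv) u u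
  rw [covarianceBilin_apply IsGaussian.memLp_two_id, integral_id_multivariateGaussian',
    dotProduct_smul_one_mulVec] at h
  rw [← h, isoGaussian]
  simp_rw [real_inner_comm u, sq]

end Gaussian


/-! ### Localized Gibbs measures and the Hessian of the envelope -/

section Gibbs

lemma tilted_add_const {α : Type*} [MeasurableSpace α] (μ : Measure α) (f : α → ℝ) (c : ℝ) :
    μ.tilted (fun y => f y + c) = μ.tilted f := by
  simp_rw [Measure.tilted, Real.exp_add, integral_mul_const,
    mul_div_mul_right _ _ (Real.exp_ne_zero c)]

variable {d : ℕ} {f : EuclideanSpace ℝ (Fin d) → ℝ} {lam δ : ℝ}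

lemma StandingAssumption.integrable_exp_gibbs (hf : StandingAssumption δ f) (hδ : 0 < δ)
    (hlam : 0 < lam) (x : EuclideanSpace ℝ (Fin d)) :
    Integrable (fun y => Real.exp (-(f y + ‖x - y‖ ^ 2 / (2 * lam)) / δ)) := by
  have := hf.continuous
  refine hf.integrable_exp.mono (Continuous.aestronglyMeasurable (by fun_prop))
    (.of_forall fun y => ?_)
  rw [Real.norm_of_nonneg (by positivity), Real.norm_of_nonneg (by positivity)]
  gcongr
  have : 0 ≤ ‖x - y‖ ^ 2 / (2 * lam) := by positivity
  linarith

lemma StandingAssumption.isProbabilityMeasure_gibbs (hf : StandingAssumption δ f) (hδ : 0 < δ)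
    (hlam : 0 < lam) (x : EuclideanSpace ℝ (Fin d)) :
    IsProbabilityMeasure (gibbs f lam δ x) :=
  isProbabilityMeasure_tilted (hf.integrable_exp_gibbs hδ hlam x)

lemma StandingAssumption.hasExpMoments_gibbs (hf : StandingAssumption δ f) (hδ : 0 < δ)
    (hlam : 0 < lam) : HasExpMoments (gibbs f lam δ 0) := by
  intro t
  have := hf.continuous
  rw [gibbs, integrable_tilted_iff (hf.integrable_exp_gibbs hδ hlam 0)]
  refine (hf.integrable_exp.const_mul (Real.exp (t ^ 2 * (lam * δ) / 2))).mono
    (Continuous.aestronglyMeasurable (by fun_prop)) (.of_forall fun y => ?_)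
  rw [Real.norm_of_nonneg (by positivity), Real.norm_of_nonneg (by positivity), smul_eq_mul,
    ← Real.exp_add, ← Real.exp_add, Real.exp_le_exp, zero_sub, norm_neg]
  -- Complete the square in `t ‖y‖ - ‖y‖² / (2 lam δ)`.
  have : 0 ≤ (‖y‖ - t * (lam * δ)) ^ 2 / (2 * (lam * δ)) := by positivity
  have e : (‖y‖ - t * (lam * δ)) ^ 2 / (2 * (lam * δ)) =
      ‖y‖ ^ 2 / (2 * lam) / δ - t * ‖y‖ + t ^ 2 * (lam * δ) / 2 := by
    field_simp
    ring
  rw [neg_div, add_div, neg_div]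
  linarith

/-- The localized Gibbs measures form an exponential family with base `gibbs f lam δ 0`. -/
lemma StandingAssumption.gibbs_eq_tilted (hf : StandingAssumption δ f) (hδ : 0 < δ)
    (hlam : 0 < lam) (x : EuclideanSpace ℝ (Fin d)) :
    gibbs f lam δ x = (gibbs f lam δ 0).tilted (fun y => (lam * δ)⁻¹ * inner ℝ x y) := by
  rw [gibbs, gibbs, tilted_tilted (hf.integrable_exp_gibbs hδ hlam 0),
    ← tilted_add_const _ _ (‖x‖ ^ 2 / (2 * lam * δ))]
  congr with y
  rw [Pi.add_apply, zero_sub, norm_neg, norm_sub_sq_real]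
  field_simp
  ring

lemma gibbs_eq_isoGaussian_tilted (hδ : 0 < δ) (hlam : 0 < lam)
    (x : EuclideanSpace ℝ (Fin d)) :
    gibbs f lam δ x = (isoGaussian x (lam * δ)).tilted (fun y => -f y / δ) := by
  have hv : 0 < lam * δ := by positivity
  rw [gibbs, isoGaussian_eq_tilted hv, tilted_tilted (integrable_exp_neg_norm_sub_sq_div hv x)]
  congr with y
  rw [Pi.add_apply]
  field_simp
  ring

lemma zprox_eq_integral_gibbs (hδ : 0 < δ) (hlam : 0 < lam) (x : EuclideanSpace ℝ (Fin d)) :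
    zprox f lam δ x = ∫ y, y ∂(gibbs f lam δ x) := by
  rw [gibbs_eq_isoGaussian_tilted hδ hlam, integral_tilted_eq_inv_smul, zprox]

/-- Up to a constant, the soft Moreau envelope is `‖x‖² / (2 lam)` minus `δ` times the log-Laplace
transform of the base measure `gibbs f lam δ 0`. -/
lemma StandingAssumption.exists_softMoreauEnvelope_eq (hf : StandingAssumption δ f) (hδ : 0 < δ)
    (hlam : 0 < lam) : ∃ c : ℝ, ∀ x : EuclideanSpace ℝ (Fin d), softMoreauEnvelope f lam δ x =
      1 / (2 * lam) * ‖x‖ ^ 2 -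
        δ * Real.log (∫ y, Real.exp ((lam * δ)⁻¹ * inner ℝ x y) ∂(gibbs f lam δ 0)) + c := by
  have hv : 0 < lam * δ := by positivity
  set Z := ∫ y : EuclideanSpace ℝ (Fin d), Real.exp (-(f y + ‖0 - y‖ ^ 2 / (2 * lam)) / δ) with hZ
  set C := ∫ y : EuclideanSpace ℝ (Fin d), Real.exp (-‖0 - y‖ ^ 2 / (2 * (lam * δ))) with hC
  have hZ0 : 0 < Z := integral_exp_pos (hf.integrable_exp_gibbs hδ hlam 0)
  have hC0 : 0 < C := integral_exp_pos (integrable_exp_neg_norm_sub_sq_div hv 0)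
  refine ⟨-δ * Real.log (Z / C), fun x => ?_⟩
  have := hf.isProbabilityMeasure_gibbs hδ hlam 0
  have hM : 0 < ∫ y, Real.exp ((lam * δ)⁻¹ * inner ℝ x y) ∂(gibbs f lam δ 0) :=
    integral_exp_pos ((hf.hasExpMoments_gibbs hδ hlam).integrable_exp_inner _ x)
  have hCx : ∫ y : EuclideanSpace ℝ (Fin d), Real.exp (-‖x - y‖ ^ 2 / (2 * (lam * δ))) = C := by
    rw [hC, ← integral_sub_left_eq_self _ volume x]
    simp
  have key : ∫ y, Real.exp (-f y / δ) ∂(isoGaussian x (lam * δ)) =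
      Real.exp (-‖x‖ ^ 2 / (2 * lam * δ)) *
        (∫ y, Real.exp ((lam * δ)⁻¹ * inner ℝ x y) ∂(gibbs f lam δ 0)) * (Z / C) := by
    rw [isoGaussian_eq_tilted hv, gibbs, integral_exp_tilted, integral_exp_tilted, hCx, ← hZ,
      mul_div_assoc', mul_assoc, div_mul_cancel₀ _ hZ0.ne', ← integral_const_mul]
    congr with y
    rw [← Real.exp_add, Pi.add_apply, Pi.add_apply, zero_sub, norm_neg, norm_sub_sq_real]
    congr 1
    field_simp
    ring
  rw [softMoreauEnvelope, key, Real.log_mul (by positivity) (by positivity),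
    Real.log_mul (by positivity) (by positivity), Real.log_exp]
  field_simp
  ring

/-- The soft Moreau envelope has gradient `(x - zprox(x)) / lam`. -/
lemma StandingAssumption.hasGradientAt_softMoreauEnvelope (hf : StandingAssumption δ f)
    (hδ : 0 < δ) (hlam : 0 < lam) (x : EuclideanSpace ℝ (Fin d)) :
    HasGradientAt (softMoreauEnvelope f lam δ) ((1 / lam) • (x - zprox f lam δ x)) x := by
  obtain ⟨c, hc⟩ := hf.exists_softMoreauEnvelope_eq hδ hlam
  have := hf.isProbabilityMeasure_gibbs hδ hlam 0
  have h1 := ((hf.hasExpMoments_gibbs hδ hlam).hasGradientAt_log_integral_exp_inner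
    (lam * δ)⁻¹ x).hasFDerivAt.const_mul δ
  have h2 := (hasStrictFDerivAt_norm_sq x).hasFDerivAt.const_mul (1 / (2 * lam))
  rw [hasGradientAt_iff_hasFDerivAt, funext hc]
  refine ((h2.sub h1).add_const c).congr_fderiv ?_
  rw [← hf.gibbs_eq_tilted hδ hlam, ← zprox_eq_integral_gibbs hδ hlam]
  ext u
  simp
  field_simp

lemma StandingAssumption.hasFDerivAt_zprox (hf : StandingAssumption δ f)
    (hδ : 0 < δ) (hlam : 0 < lam) (x : EuclideanSpace ℝ (Fin d)) :
    HasFDerivAt (zprox f lam δ) ((1 / (lam * δ)) • gibbsCovariance f lam δ x) x := by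
  have := hf.isProbabilityMeasure_gibbs hδ hlam 0
  have hz : zprox f lam δ = fun x =>
      ∫ y, y ∂((gibbs f lam δ 0).tilted fun y => (lam * δ)⁻¹ * inner ℝ x y) := by
    ext1 x
    rw [← hf.gibbs_eq_tilted hδ hlam, zprox_eq_integral_gibbs hδ hlam]
  have h := (hf.hasExpMoments_gibbs hδ hlam).hasFDerivAt_mean_tilted (lam * δ)⁻¹ x
    (congr_fun hz x).symm
  rwa [← hz, ← hf.gibbs_eq_tilted hδ hlam, ← one_div] at h

/-- The Hessian of the soft Moreau envelope. -/
lemma StandingAssumption.hasFDerivAt_gradient_softMoreauEnvelope (hf : StandingAssumption δ f)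
    (hδ : 0 < δ) (hlam : 0 < lam) (x : EuclideanSpace ℝ (Fin d)) :
    HasFDerivAt (gradient (softMoreauEnvelope f lam δ))
      ((1 / lam) • ContinuousLinearMap.id ℝ (EuclideanSpace ℝ (Fin d)) -
        (1 / (lam ^ 2 * δ)) • gibbsCovariance f lam δ x) x := by
  rw [gradient_eq (hf.hasGradientAt_softMoreauEnvelope hδ hlam)]
  refine (((hasFDerivAt_id x).sub (hf.hasFDerivAt_zprox hδ hlam x)).const_smul
    (1 / lam)).congr_fderiv ?_
  rw [smul_sub, smul_smul]
  congr 2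
  field_simp

lemma StandingAssumption.integrable_gibbs (hf : StandingAssumption δ f)
    (hδ : 0 < δ) (hlam : 0 < lam) (x : EuclideanSpace ℝ (Fin d)) {F : Type*}
    [NormedAddCommGroup F] [NormedSpace ℝ F] {g : EuclideanSpace ℝ (Fin d) → F}
    (hg : Continuous g) {k : ℕ} (hgk : ∀ y, ‖g y‖ ≤ ‖y‖ ^ k) :
    Integrable g (gibbs f lam δ x) := by
  rw [hf.gibbs_eq_tilted hδ hlam]
  exact (hf.hasExpMoments_gibbs hδ hlam).integrable_tilted hg hgk _ _

lemma StandingAssumption.inner_gibbsCovariance (hf : StandingAssumption δ f)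
    (hδ : 0 < δ) (hlam : 0 < lam) (x u : EuclideanSpace ℝ (Fin d)) :
    inner ℝ (gibbsCovariance f lam δ x u) u =
      ∫ y, inner ℝ (y - zprox f lam δ x) u ^ 2 ∂(gibbs f lam δ x) := by
  have := hf.isProbabilityMeasure_gibbs hδ hlam x
  set z := zprox f lam δ x with hz
  have hi : Integrable (fun y => (innerSL ℝ (y - z)).smulRight (y - z)) (gibbs f lam δ x) := by
    have h2 : Integrable (fun y => ‖y‖ ^ 2) (gibbs f lam δ x) :=
      hf.integrable_gibbs hδ hlam x (k := 2) (by fun_prop) (by simp)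
    refine ((h2.const_mul 2).add (integrable_const (2 * ‖z‖ ^ 2))).mono'
      (Continuous.aestronglyMeasurable (by fun_prop)) (.of_forall fun y => ?_)
    rw [ContinuousLinearMap.norm_smulRight_apply, innerSL_apply_norm, Pi.add_apply]
    nlinarith [norm_sub_le y z, norm_nonneg (y - z), sq_nonneg (‖y‖ - ‖z‖)]
  let L : (EuclideanSpace ℝ (Fin d) →L[ℝ] EuclideanSpace ℝ (Fin d)) →L[ℝ] ℝ :=
    (innerSL ℝ u).comp (ContinuousLinearMap.apply ℝ (EuclideanSpace ℝ (Fin d)) u)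
  have hL : ∀ A, inner ℝ (A u) u = L A := fun A => real_inner_comm _ _
  rw [gibbsCovariance, hL, ← L.integral_comp_comm hi]
  congr with y
  rw [← hL]
  simp [inner_smul_left, inner_sub_left, sq]

end Gibbs

/-! ### A second-order criterion for convexity -/

section Convexity

/-- Second-order criterion for convexity on a convex set. -/
lemma convexOn_of_hessian_nonneg {E : Type*} [NormedAddCommGroup E] [InnerProductSpace ℝ E]
    [CompleteSpace E] {S : Set E} (hS : Convex ℝ S) {F : E → ℝ} {G : E → E} {H : E → E →L[ℝ] E}
    (hF : ∀ x, HasGradientAt F (G x) x) (hG : ∀ x, HasFDerivAt G (H x) x)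
    (hH : ∀ x ∈ S, ∀ u, 0 ≤ inner ℝ (H x u) u) : ConvexOn ℝ S F := by
  refine ⟨hS, fun x hx y hy a b ha hb hab => ?_⟩
  have hline : ∀ t : ℝ, HasDerivAt (fun t : ℝ => x + t • (y - x)) (y - x) t := fun t => by
    simpa using ((hasDerivAt_id t).smul_const (y - x)).const_add x
  have hconv : ConvexOn ℝ (Set.Icc 0 1) (fun t : ℝ => F (x + t • (y - x))) := by
    refine convexOn_of_hasDerivWithinAt2_nonneg (convex_Icc 0 1)
      (f' := fun t => inner ℝ (G (x + t • (y - x))) (y - x))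
      (f'' := fun t => inner ℝ (H (x + t • (y - x)) (y - x)) (y - x)) ?_ ?_ ?_ ?_
    · exact fun t _ => ((hF _).hasFDerivAt.comp_hasDerivAt t
        (hline t)).continuousAt.continuousWithinAt
    · intro t _
      exact ((hF _).hasFDerivAt.comp_hasDerivAt t (hline t)).hasDerivWithinAt
    · intro t _
      have := ((hG _).comp_hasDerivAt t (hline t)).inner ℝ (hasDerivAt_const t (y - x))
      simpa using this.hasDerivWithinAt
    · intro t ht
      rw [interior_Icc] at ht
      exact hH _ (hS.add_smul_sub_mem hx hy ⟨ht.1.le, ht.2.le⟩) _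
  have h := hconv.2 (x := 0) (y := 1) (by simp) (by simp) ha hb hab
  have e : x + b • (y - x) = a • x + b • y := by
    rw [← sub_eq_of_eq_add' hab.symm]; module
  simpa [e] using h

/-- The soft Moreau envelope is convex where the covariance of the localized Gibbs measure is at
most `lam δ I`. -/
lemma StandingAssumption.convexOn_softMoreauEnvelope {d : ℕ} {f : EuclideanSpace ℝ (Fin d) → ℝ}
    {lam δ : ℝ} (hf : StandingAssumption δ f)
    (hδ : 0 < δ) (hlam : 0 < lam) {S : Set (EuclideanSpace ℝ (Fin d))} (hS : Convex ℝ S)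
    (h : ∀ x ∈ S, ∀ u, ∫ y, inner ℝ (y - zprox f lam δ x) u ^ 2 ∂(gibbs f lam δ x) ≤
      lam * δ * ‖u‖ ^ 2) : ConvexOn ℝ S (softMoreauEnvelope f lam δ) := by
  refine convexOn_of_hessian_nonneg hS
    (fun x => (hf.hasGradientAt_softMoreauEnvelope hδ hlam x).differentiableAt.hasGradientAt)
    (hf.hasFDerivAt_gradient_softMoreauEnvelope hδ hlam) fun x hx u => ?_
  have := h x hx u
  rw [← hf.inner_gibbsCovariance hδ hlam] at this
  simp [inner_sub_left, inner_smul_left]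
  field_simp
  linarith

end Convexity


/-! ### Moments of the localized Gibbs measures -/

section Variance

variable {d : ℕ} {f : EuclideanSpace ℝ (Fin d) → ℝ} {lam δ : ℝ}

lemma StandingAssumption.integrable_id_gibbs (hf : StandingAssumption δ f)
    (hδ : 0 < δ) (hlam : 0 < lam) (x : EuclideanSpace ℝ (Fin d)) :
    Integrable (fun y => y) (gibbs f lam δ x) :=
  hf.integrable_gibbs hδ hlam x (k := 1) continuous_id (by simp)

lemma StandingAssumption.integrable_norm_sq_gibbs (hf : StandingAssumption δ f)
    (hδ : 0 < δ) (hlam : 0 < lam) (x : EuclideanSpace ℝ (Fin d)) :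
    Integrable (fun y => ‖y‖ ^ 2) (gibbs f lam δ x) :=
  hf.integrable_gibbs hδ hlam x (k := 2) (by fun_prop) (by simp)

lemma StandingAssumption.integral_inner_gibbs (hf : StandingAssumption δ f)
    (hδ : 0 < δ) (hlam : 0 < lam) (x u : EuclideanSpace ℝ (Fin d)) :
    ∫ y, inner ℝ u y ∂(gibbs f lam δ x) = inner ℝ u (zprox f lam δ x) := by
  rw [zprox_eq_integral_gibbs hδ hlam]
  exact integral_inner (hf.integrable_id_gibbs hδ hlam x) u

lemma inner_sub_sq_le {E : Type*} [NormedAddCommGroup E] [InnerProductSpace ℝ E] (y c u : E) :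
    inner ℝ (y - c) u ^ 2 ≤ ‖y - c‖ ^ 2 * ‖u‖ ^ 2 := by
  rw [← mul_pow, ← sq_abs]
  gcongr
  exact abs_real_inner_le_norm _ _

lemma StandingAssumption.integrable_inner_sub_sq_gibbs (hf : StandingAssumption δ f)
    (hδ : 0 < δ) (hlam : 0 < lam) (x c u : EuclideanSpace ℝ (Fin d)) :
    Integrable (fun y => inner ℝ (y - c) u ^ 2) (gibbs f lam δ x) := by
  have := hf.isProbabilityMeasure_gibbs hδ hlam x
  refine ((((hf.integrable_norm_sq_gibbs hδ hlam x).const_mul 2).add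
    (integrable_const (2 * ‖c‖ ^ 2))).mul_const (‖u‖ ^ 2)).mono'
    (Continuous.aestronglyMeasurable (by fun_prop)) (.of_forall fun y => ?_)
  rw [Real.norm_of_nonneg (by positivity), Pi.add_apply]
  refine (inner_sub_sq_le y c u).trans ?_
  gcongr
  nlinarith [norm_sub_le y c, norm_nonneg (y - c), sq_nonneg (‖y‖ - ‖c‖)]

/-- The mean minimizes the quadratic deviation. -/
lemma StandingAssumption.integral_inner_sub_zprox_sq_le (hf : StandingAssumption δ f)
    (hδ : 0 < δ) (hlam : 0 < lam) (x c u : EuclideanSpace ℝ (Fin d)) :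
    ∫ y, inner ℝ (y - zprox f lam δ x) u ^ 2 ∂(gibbs f lam δ x) ≤
      ∫ y, inner ℝ (y - c) u ^ 2 ∂(gibbs f lam δ x) := by
  have := hf.isProbabilityMeasure_gibbs hδ hlam x
  set z := zprox f lam δ x with hz
  have hu : Integrable (fun y => inner ℝ u y) (gibbs f lam δ x) :=
    (hf.integrable_id_gibbs hδ hlam x).const_inner u
  have h1 : ∫ y, inner ℝ (y - c) u ^ 2 ∂(gibbs f lam δ x) -
      ∫ y, inner ℝ (y - z) u ^ 2 ∂(gibbs f lam δ x) = inner ℝ u (z - c) ^ 2 := by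
    rw [← integral_sub (hf.integrable_inner_sub_sq_gibbs hδ hlam x c u)
      (hf.integrable_inner_sub_sq_gibbs hδ hlam x z u)]
    have e : ∀ y, inner ℝ (y - c) u ^ 2 - inner ℝ (y - z) u ^ 2 =
        2 * inner ℝ u (z - c) * inner ℝ u y - inner ℝ u (z - c) * inner ℝ u (z + c) := by
      intro y
      simp only [real_inner_comm u, inner_sub_right, inner_add_right]
      ring
    simp_rw [e]
    rw [integral_sub (hu.const_mul _) (integrable_const _), integral_const_mul,
      hf.integral_inner_gibbs hδ hlam, integral_const, ← hz]
    simp only [probReal_univ, one_smul, inner_sub_right, inner_add_right]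
    ring
  linarith [sq_nonneg (inner ℝ u (z - c))]

end Variance

/-! ### Convexity on balls under dissipativity -/

section Dissipative

variable {d : ℕ} {f : EuclideanSpace ℝ (Fin d) → ℝ} {lam δ m b : ℝ}

/-- Integrated form of dissipativity along the segment from `t y` to `y`. -/
lemma sub_comp_smul_ge_of_dissipative {E : Type*} [NormedAddCommGroup E] [InnerProductSpace ℝ E]
    [CompleteSpace E] {f : E → ℝ} (hC : Differentiable ℝ f) (hm : 0 ≤ m) (hb : 0 ≤ b)
    (hdiss : ∀ y, m * ‖y‖ ^ 2 - b ≤ inner ℝ (gradient f y) y) {t : ℝ} (ht0 : 0 < t) (ht1 : t ≤ 1)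
    (y : E) : (1 - t) * (m * t * ‖y‖ ^ 2 - b / t) ≤ f y - f (t • y) := by
  have hder : ∀ s : ℝ, HasDerivAt (fun s : ℝ => f (s • y)) (inner ℝ (gradient f (s • y)) y) s := by
    intro s
    have hl : HasDerivAt (fun s : ℝ => s • y) y s := by
      simpa using (hasDerivAt_id s).smul_const y
    exact (hC (s • y)).hasGradientAt.hasFDerivAt.comp_hasDerivAt s hl
  have h := (convex_Icc t 1).mul_sub_le_image_sub_of_le_deriv (f := fun s : ℝ => f (s • y))
    (C := m * t * ‖y‖ ^ 2 - b / t)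
    (fun s _ => (hder s).continuousAt.continuousWithinAt)
    (fun s _ => (hder s).differentiableAt.differentiableWithinAt) ?_
    t (by simp [ht1]) 1 (by simp [ht1]) ht1
  · simpa [mul_comm] using h
  · intro s hs
    rw [interior_Icc] at hs
    have hs0 : 0 < s := ht0.trans hs.1
    rw [(hder s).deriv]
    have h1 := hdiss (s • y)
    rw [inner_smul_right, norm_smul, Real.norm_of_nonneg hs0.le] at h1
    have h2 : m * s * ‖y‖ ^ 2 - b / s ≤ inner ℝ (gradient f (s • y)) y := by
      rw [← mul_le_mul_iff_right₀ hs0]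
      refine le_trans (le_of_eq ?_) h1
      field_simp
    refine le_trans ?_ h2
    have := hs.1.le
    gcongr

/-- With `U(y) = f(y) + ‖x - y‖² / (2 lam)`, the integral of `exp (-U(t y) / δ)` is `t⁻ᵈ` times
that of `exp (-U(y) / δ)`; bounding `U(y) - U(t y)` from below by dissipativity and linearizing the
exponential turns this identity into a bound on moments of the Gibbs measure. -/
lemma StandingAssumption.pow_mul_moment_le_of_dissipative (hf : StandingAssumption δ f)
    (hδ : 0 < δ) (hlam : 0 < lam) (hC : Differentiable ℝ f) (hm : 0 ≤ m) (hb : 0 ≤ b)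
    (hdiss : ∀ y, m * ‖y‖ ^ 2 - b ≤ inner ℝ (gradient f y) y) {t : ℝ} (ht0 : 0 < t) (ht1 : t < 1)
    (x : EuclideanSpace ℝ (Fin d)) :
    t ^ d * ((m + 1 / lam) * t * ∫ y, ‖y‖ ^ 2 ∂(gibbs f lam δ x) - b / t -
      1 / lam * inner ℝ x (zprox f lam δ x)) ≤ δ * d := by
  have hprob := hf.isProbabilityMeasure_gibbs hδ hlam x
  set μ := gibbs f lam δ x with hμ
  set U : EuclideanSpace ℝ (Fin d) → ℝ := fun y => -(f y + ‖x - y‖ ^ 2 / (2 * lam)) / δ with hU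
  have hUi : Integrable (fun y => Real.exp (U y)) := hf.integrable_exp_gibbs hδ hlam x
  set h : EuclideanSpace ℝ (Fin d) → ℝ := fun y =>
    (m + 1 / lam) * t * ‖y‖ ^ 2 - b / t - 1 / lam * inner ℝ x y with hh
  have i2 := (hf.integrable_norm_sq_gibbs hδ hlam x).const_mul ((m + 1 / lam) * t)
  have i1 : Integrable (fun y => 1 / lam * inner ℝ x y) μ :=
    ((hf.integrable_id_gibbs hδ hlam x).const_inner x).const_mul _
  have i20 : Integrable (fun y => (m + 1 / lam) * t * ‖y‖ ^ 2 - b / t) μ :=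
    i2.sub (integrable_const _)
  have hi : Integrable h μ := i20.sub i1
  have hEh : ∫ y, h y ∂μ = (m + 1 / lam) * t * ∫ y, ‖y‖ ^ 2 ∂μ - b / t -
      1 / lam * inner ℝ x (zprox f lam δ x) := by
    rw [hh, integral_sub i20 i1, integral_sub i2 (integrable_const _),
      integral_const_mul, integral_const_mul, hf.integral_inner_gibbs hδ hlam, integral_const,
      probReal_univ, one_smul]
  rw [← hEh]
  have hpt : ∀ y, Real.exp (U y) * (1 + (1 - t) / δ * h y) ≤ Real.exp (U (t • y)) := by
    intro y
    have h1 := sub_comp_smul_ge_of_dissipative hC hm hb hdiss ht0 ht1.le y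
    have h2 : (1 - t) / δ * h y ≤ U (t • y) - U y := by
      have e : U (t • y) - U y - (1 - t) / δ * h y =
          (f y - f (t • y) - (1 - t) * (m * t * ‖y‖ ^ 2 - b / t)
            + (1 - t) ^ 2 * ‖y‖ ^ 2 / (2 * lam)) / δ := by
        simp only [hU, hh, norm_sub_sq_real, inner_smul_right, norm_smul,
          Real.norm_of_nonneg ht0.le]
        field_simp
        ring
      have : 0 ≤ U (t • y) - U y - (1 - t) / δ * h y := by
        rw [e]
        have : 0 ≤ (1 - t) ^ 2 * ‖y‖ ^ 2 / (2 * lam) := by positivity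
        apply div_nonneg _ hδ.le
        linarith
      linarith
    calc _ ≤ Real.exp (U y) * Real.exp ((1 - t) / δ * h y) := by
          gcongr
          rw [add_comm]
          exact Real.add_one_le_exp _
      _ ≤ _ := by
          rw [← Real.exp_add, Real.exp_le_exp]
          linarith
  have hi' : Integrable (fun y => 1 + (1 - t) / δ * h y) μ :=
    (integrable_const 1).add (hi.const_mul _)
  have hZ : 0 < ∫ y, Real.exp (U y) := integral_exp_pos hUi
  have hle := integral_mono ((integrable_tilted_iff hUi _).1 hi')
    ((integrable_comp_smul_iff volume (fun y => Real.exp (U y)) ht0.ne').2 hUi) hpt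
  have htilt := integral_tilted_eq_inv_smul volume U (fun y => 1 + (1 - t) / δ * h y)
  rw [eq_inv_smul_iff₀ hZ.ne'] at htilt
  rw [← htilt, Measure.integral_comp_smul_of_nonneg _ (fun y => Real.exp (U y)) t (hR := ht0.le),
    finrank_euclideanSpace_fin,
    smul_eq_mul, smul_eq_mul, mul_comm, mul_le_mul_iff_left₀ hZ] at hle
  change ∫ y, 1 + (1 - t) / δ * h y ∂μ ≤ _ at hle
  rw [integral_add (integrable_const 1) (hi.const_mul _), integral_const_mul, integral_const,
    probReal_univ, one_smul] at hle
  have htd : 0 < t ^ d := by positivity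
  rw [← one_div, le_div_iff₀ htd] at hle
  -- Bernoulli's inequality bounds `1 - t ^ d` by `d (1 - t)`.
  have hB := one_add_mul_le_pow (a := t - 1) (by linarith) d
  rw [add_sub_cancel] at hB
  have ht1' : 0 < (1 - t) / δ := div_pos (by linarith) hδ
  rw [← mul_le_mul_iff_right₀ ht1']
  have e : (1 - t) / δ * (δ * d) = d * (1 - t) := by field_simp
  rw [e]
  linarith

/-- The inequality that integration by parts against the vector field `y ↦ y` would give; here it is
the limit `t → 1` of `pow_mul_moment_le_of_dissipative`. -/
lemma StandingAssumption.moment_le_of_dissipative (hf : StandingAssumption δ f)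
    (hδ : 0 < δ) (hlam : 0 < lam) (hC : Differentiable ℝ f) (hm : 0 ≤ m) (hb : 0 ≤ b)
    (hdiss : ∀ y, m * ‖y‖ ^ 2 - b ≤ inner ℝ (gradient f y) y)
    (x : EuclideanSpace ℝ (Fin d)) :
    (m + 1 / lam) * ∫ y, ‖y‖ ^ 2 ∂(gibbs f lam δ x) - b -
      1 / lam * inner ℝ x (zprox f lam δ x) ≤ δ * d := by
  set A := ∫ y, ‖y‖ ^ 2 ∂(gibbs f lam δ x)
  set q := 1 / lam * inner ℝ x (zprox f lam δ x)
  have hcont : ContinuousAt (fun t : ℝ => t ^ d * ((m + 1 / lam) * t * A - b / t - q)) 1 := by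
    fun_prop (disch := norm_num)
  have hlim := hcont.tendsto.mono_left (nhdsWithin_le_nhds (s := Set.Iio 1))
  simp only [one_pow, one_mul, mul_one, div_one] at hlim
  refine le_of_tendsto hlim ?_
  filter_upwards [Ioo_mem_nhdsLT (zero_lt_one' ℝ)] with t ht
  exact hf.pow_mul_moment_le_of_dissipative hδ hlam hC hm hb hdiss ht.1 ht.2 x

/-- A number above the larger root of `c L² - p L - R² / 2` makes this quadratic nonnegative. -/
lemma quadratic_ge_of_root_le {c p R L : ℝ} (hc : 0 < c)
    (h : (p + Real.sqrt (p ^ 2 + 2 * c * R ^ 2)) / (2 * c) ≤ L) :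
    p * L + R ^ 2 / 2 ≤ c * L ^ 2 := by
  rw [div_le_iff₀ (by positivity)] at h
  have h1 := Real.sq_sqrt (show 0 ≤ p ^ 2 + 2 * c * R ^ 2 by positivity)
  have h2 := Real.sqrt_nonneg (p ^ 2 + 2 * c * R ^ 2)
  have h3 : p ^ 2 + 2 * c * R ^ 2 ≤ (L * (2 * c) - p) ^ 2 := by
    rw [← h1]
    gcongr
    linarith
  have h4 : 0 ≤ 4 * c * (c * L ^ 2 - (p * L + R ^ 2 / 2)) := by nlinarith
  have := nonneg_of_mul_nonneg_right h4 (by positivity)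
  linarith

/-- Dissipativity bounds the second moment of the localized Gibbs measures centred in a ball. -/
lemma StandingAssumption.integral_norm_sq_gibbs_le (hf : StandingAssumption δ f)
    (hδ : 0 < δ) (hlam : 0 < lam) (hC : Differentiable ℝ f) (hm : 0 < m) (hb : 0 ≤ b)
    (hdiss : ∀ y, m * ‖y‖ ^ 2 - b ≤ inner ℝ (gradient f y) y) {R : ℝ}
    (hR : (δ * d + b + Real.sqrt ((δ * d + b) ^ 2 + 2 * δ * m * R ^ 2)) / (2 * δ * m) ≤ lam)
    {x : EuclideanSpace ℝ (Fin d)} (hx : ‖x‖ ≤ R) :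
    ∫ y, ‖y‖ ^ 2 ∂(gibbs f lam δ x) ≤ lam * δ := by
  have hprob := hf.isProbabilityMeasure_gibbs hδ hlam x
  have h1 := hf.moment_le_of_dissipative hδ hlam hC hm.le hb hdiss x
  have hq := quadratic_ge_of_root_le (c := δ * m) (p := δ * d + b) (R := R) (L := lam)
    (by positivity) (by simpa only [mul_assoc] using hR)
  have i2 := hf.integrable_norm_sq_gibbs hδ hlam x
  have i1 : Integrable (fun y => 2 * inner ℝ x y) (gibbs f lam δ x) :=
    ((hf.integrable_id_gibbs hδ hlam x).const_inner x).const_mul _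
  have h2 : 0 ≤ ‖x‖ ^ 2 - 2 * inner ℝ x (zprox f lam δ x) + ∫ y, ‖y‖ ^ 2 ∂(gibbs f lam δ x) := by
    have : 0 ≤ ∫ y, ‖x - y‖ ^ 2 ∂(gibbs f lam δ x) := integral_nonneg fun y => by positivity
    simp_rw [norm_sub_sq_real] at this
    have i10 : Integrable (fun y => ‖x‖ ^ 2 - 2 * inner ℝ x y) (gibbs f lam δ x) :=
      (integrable_const _).sub i1
    rw [integral_add i10 i2, integral_sub (integrable_const _) i1,
      integral_const_mul, hf.integral_inner_gibbs hδ hlam, integral_const] at this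
    simpa using this
  have h3 : 0 ≤ ∫ y, ‖y‖ ^ 2 ∂(gibbs f lam δ x) := integral_nonneg fun y => by positivity
  set A := ∫ y, ‖y‖ ^ 2 ∂(gibbs f lam δ x)
  set w := inner ℝ x (zprox f lam δ x)
  have hx2 : ‖x‖ ^ 2 ≤ R ^ 2 := by gcongr
  have h4 : (m * lam + 1) * A - b * lam - w ≤ δ * d * lam := by
    have e : ((m + 1 / lam) * A - b - 1 / lam * w) * lam = (m * lam + 1) * A - b * lam - w := by
      field_simp
    rw [← e]
    exact mul_le_mul_of_nonneg_right h1 hlam.le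
  -- Combine `h4` with `2 w ≤ R ^ 2 + A` and the quadratic inequality in `lam`.
  have h5 : (m * lam) * A ≤ (m * lam) * (lam * δ) := by nlinarith
  exact le_of_mul_le_mul_left h5 (by positivity)

lemma StandingAssumption.convexOn_of_dissipative (hf : StandingAssumption δ f)
    (hδ : 0 < δ) (hlam : 0 < lam) (hC : Differentiable ℝ f) (hm : 0 < m) (hb : 0 ≤ b)
    (hdiss : ∀ y, m * ‖y‖ ^ 2 - b ≤ inner ℝ (gradient f y) y) {R : ℝ}
    (hR : (δ * d + b + Real.sqrt ((δ * d + b) ^ 2 + 2 * δ * m * R ^ 2)) / (2 * δ * m) ≤ lam) :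
    ConvexOn ℝ (Metric.closedBall (0 : EuclideanSpace ℝ (Fin d)) R)
      (softMoreauEnvelope f lam δ) := by
  refine hf.convexOn_softMoreauEnvelope hδ hlam (convex_closedBall _ _) fun x hx u => ?_
  refine (hf.integral_inner_sub_zprox_sq_le hδ hlam x 0 u).trans ?_
  calc ∫ y, inner ℝ (y - 0) u ^ 2 ∂(gibbs f lam δ x)
      ≤ ∫ y, ‖y‖ ^ 2 * ‖u‖ ^ 2 ∂(gibbs f lam δ x) :=
        integral_mono (hf.integrable_inner_sub_sq_gibbs hδ hlam x 0 u)
          ((hf.integrable_norm_sq_gibbs hδ hlam x).mul_const _)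
          fun y => by simpa using inner_sub_sq_le y 0 u
    _ = (∫ y, ‖y‖ ^ 2 ∂(gibbs f lam δ x)) * ‖u‖ ^ 2 := integral_mul_const _ _
    _ ≤ _ := by
        gcongr
        exact hf.integral_norm_sq_gibbs_le hδ hlam hC hm hb hdiss hR (by simpa using hx)

end Dissipative

/-! ### Convexity under bounded perturbation of a quadratic -/

section Oscillation

/-- A tilt by a function with values in `[a, b]` increases integrals of nonnegative functions at
most by the factor `exp (b - a)`. -/
lemma integral_tilted_le_exp_mul {α : Type*} [MeasurableSpace α] (γ : Measure α)
    [IsProbabilityMeasure γ] {φ g : α → ℝ} {a b : ℝ} (hφ : AEStronglyMeasurable φ γ)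
    (ha : ∀ y, a ≤ φ y) (hb : ∀ y, φ y ≤ b) (hg : Integrable g γ) (hg0 : ∀ y, 0 ≤ g y) :
    ∫ y, g y ∂(γ.tilted φ) ≤ Real.exp (b - a) * ∫ y, g y ∂γ := by
  have hm : AEStronglyMeasurable (fun y => Real.exp (φ y)) γ :=
    Real.continuous_exp.comp_aestronglyMeasurable hφ
  have hbd : ∀ y, ‖Real.exp (φ y)‖ ≤ Real.exp b := fun y => by
    rw [Real.norm_of_nonneg (by positivity)]
    exact Real.exp_le_exp.2 (hb y)
  have hi : Integrable (fun y => Real.exp (φ y)) γ :=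
    (integrable_const (Real.exp b)).mono' hm (.of_forall hbd)
  have h1 : Real.exp a ≤ ∫ y, Real.exp (φ y) ∂γ := by
    have := integral_mono (integrable_const (Real.exp a)) hi fun y => Real.exp_le_exp.2 (ha y)
    simpa using this
  have h2 : ∫ y, Real.exp (φ y) • g y ∂γ ≤ Real.exp b * ∫ y, g y ∂γ := by
    rw [← integral_const_mul]
    refine integral_mono (hg.bdd_mul hm (.of_forall hbd)) (hg.const_mul _) fun y => ?_
    exact mul_le_mul_of_nonneg_right (Real.exp_le_exp.2 (hb y)) (hg0 y)
  rw [integral_tilted_eq_inv_smul, smul_eq_mul, sub_eq_neg_add, Real.exp_add, Real.exp_neg,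
    mul_assoc]
  have h0 : 0 ≤ ∫ y, Real.exp (φ y) • g y ∂γ :=
    integral_nonneg fun y => mul_nonneg (Real.exp_pos _).le (hg0 y)
  gcongr

variable {d : ℕ} {f V : EuclideanSpace ℝ (Fin d) → ℝ} {lam δ κ : ℝ}

/-- For a bounded perturbation of a quadratic, the localized Gibbs measure is a tilt by the
perturbation of a Gaussian. -/
lemma gibbs_eq_isoGaussian_tilted_of_quadratic (hδ : 0 < δ) (hlam : 0 < lam) (hκ : 0 < κ)
    (hV : ∀ y, f y = κ / 2 * ‖y‖ ^ 2 + V y) (x : EuclideanSpace ℝ (Fin d)) :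
    gibbs f lam δ x = (isoGaussian ((κ * lam + 1)⁻¹ • x) (lam * δ / (κ * lam + 1))).tilted
      (fun y => -V y / δ) := by
  have hK : 0 < κ * lam + 1 := by positivity
  have hv : 0 < lam * δ / (κ * lam + 1) := by positivity
  rw [isoGaussian_eq_tilted hv, tilted_tilted (integrable_exp_neg_norm_sub_sq_div hv _), gibbs,
    ← tilted_add_const _ _ (‖x‖ ^ 2 / (2 * lam * δ) - ‖x‖ ^ 2 / (2 * lam * δ * (κ * lam + 1)))]
  congr with y
  rw [Pi.add_apply, hV, norm_sub_sq_real, norm_sub_sq_real, inner_smul_left, norm_smul,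
    Real.norm_of_nonneg (by positivity)]
  simp only [conj_trivial]
  field_simp
  ring

lemma StandingAssumption.convexOn_of_bounded_perturbation (hf : StandingAssumption δ f)
    (hδ : 0 < δ) (hlam : 0 < lam) (hκ : 0 < κ) (hV : ∀ y, f y = κ / 2 * ‖y‖ ^ 2 + V y)
    (hVa : BddAbove (Set.range V)) (hVb : BddBelow (Set.range V))
    (h : (Real.exp (osc V / δ) - 1) / κ ≤ lam) :
    ConvexOn ℝ Set.univ (softMoreauEnvelope f lam δ) := by
  refine hf.convexOn_softMoreauEnvelope hδ hlam convex_univ fun x _ u => ?_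
  refine (hf.integral_inner_sub_zprox_sq_le hδ hlam x ((κ * lam + 1)⁻¹ • x) u).trans ?_
  have hK : 0 < κ * lam + 1 := by positivity
  have hVc : Continuous V := by
    have : V = fun y => f y - κ / 2 * ‖y‖ ^ 2 := by ext y; rw [hV]; ring
    have hfc := hf.continuous
    rw [this]
    fun_prop
  rw [gibbs_eq_isoGaussian_tilted_of_quadratic hδ hlam hκ hV]
  refine (integral_tilted_le_exp_mul (a := -(⨆ y, V y) / δ) (b := -(⨅ y, V y) / δ) _
    (Continuous.aestronglyMeasurable (by fun_prop)) (fun y => ?_) (fun y => ?_) ?_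
    (fun y => sq_nonneg _)).trans ?_
  · gcongr
    exact le_ciSup hVa y
  · gcongr
    exact ciInf_le hVb y
  · have := (((memLp_id_isoGaussian ((κ * lam + 1)⁻¹ • x) (lam * δ / (κ * lam + 1))).sub
      (memLp_const ((κ * lam + 1)⁻¹ • x))).inner_const u).integrable_sq
    simpa using this
  · rw [integral_inner_sub_sq_isoGaussian (by positivity)]
    rw [div_le_iff₀ hκ] at h
    have e : -(⨅ y, V y) / δ - -(⨆ y, V y) / δ = osc V / δ := by rw [osc]; ring
    rw [e]
    calc Real.exp (osc V / δ) * (lam * δ / (κ * lam + 1) * ‖u‖ ^ 2)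
        ≤ (κ * lam + 1) * (lam * δ / (κ * lam + 1) * ‖u‖ ^ 2) := by
          gcongr
          linarith
      _ = lam * δ * ‖u‖ ^ 2 := by field_simp

end Oscillation

end SoftMoreau

theorem theorem4 {d : ℕ} {δ : ℝ} (hδ : 0 < δ) (f : EuclideanSpace ℝ (Fin d) → ℝ)
    (hf : SoftMoreau.StandingAssumption δ f) :
    -- the envelope is twice differentiable and its Hessian is `I / lam - Σ(x) / (lam² δ)`
    (∀ lam : ℝ, 0 < lam →
      Differentiable ℝ (SoftMoreau.softMoreauEnvelope f lam δ) ∧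
      ∀ x : EuclideanSpace ℝ (Fin d),
        HasFDerivAt (gradient (SoftMoreau.softMoreauEnvelope f lam δ))
          ((1 / lam) • ContinuousLinearMap.id ℝ (EuclideanSpace ℝ (Fin d)) -
            (1 / (lam ^ 2 * δ)) • SoftMoreau.gibbsCovariance f lam δ x) x) ∧
    -- (i) local convexification under dissipativity
    (∀ m b : ℝ, 0 < m → 0 ≤ b → ContDiff ℝ 1 f →
      (∀ y : EuclideanSpace ℝ (Fin d), m * ‖y‖ ^ 2 - b ≤ inner ℝ (gradient f y) y) →
      ∀ R : ℝ, 0 < R → ∀ lam : ℝ, 0 < lam →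
        (δ * d + b + Real.sqrt ((δ * d + b) ^ 2 + 2 * δ * m * R ^ 2)) / (2 * δ * m) ≤ lam →
        ConvexOn ℝ (Metric.closedBall (0 : EuclideanSpace ℝ (Fin d)) R)
          (SoftMoreau.softMoreauEnvelope f lam δ)) ∧
    -- (ii) global convexification under bounded oscillation
    (∀ (κ : ℝ) (V : EuclideanSpace ℝ (Fin d) → ℝ), 0 < κ →
      (∀ y, f y = κ / 2 * ‖y‖ ^ 2 + V y) →
      BddAbove (Set.range V) → BddBelow (Set.range V) →
      ∀ lam : ℝ, 0 < lam →
        (Real.exp (SoftMoreau.osc V / δ) - 1) / κ ≤ lam →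
        ConvexOn ℝ Set.univ (SoftMoreau.softMoreauEnvelope f lam δ)) := by
  refine ⟨fun lam hlam => ⟨fun x => ?_, fun x => ?_⟩, ?_, ?_⟩
  · exact (hf.hasGradientAt_softMoreauEnvelope hδ hlam x).differentiableAt
  · exact hf.hasFDerivAt_gradient_softMoreauEnvelope hδ hlam x
  · intro m b hm hb hC hdiss R _ lam hlam hR
    exact hf.convexOn_of_dissipative hδ hlam (hC.differentiable one_ne_zero) hm hb hdiss hR
  · intro κ V hκ hV hVa hVb lam hlam h
    exact hf.convexOn_of_bounded_perturbation hδ hlam hκ hV hVa hVb h
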